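/- Theorem 2 (randomization mechanism). Let $K\ge 1$ clients hold model information $W_k^{\mathcal O}\sim P_k^{\mathcal O}=\mathcal N(\mu_0,\Sigma_0)$ in $\mathbb R^n$, $\Sigma_0=\mathrm{diag}(\sigma_1^2,\dots,\sigma_n^2)$ with all $\sigma_i>0$, and let each client release $W_k^{\mathcal S}=W_k^{\mathcal O}+\epsilon_k$ with noise $\epsilon_k\sim\mathcal N(0,\sigma_\epsilon^2 I_n)$, $\sigma_\epsilon\ge 0$, where $W_1^{\mathcal O},\dots,W_K^{\mathcal O},\epsilon_1,\dots,\epsilon_K$ are independent. Let $P_k^{\mathcal S}$ be the law of $W_k^{\mathcal S}$, let $P_a^{\mathcal O}$ and $P_a^{\mathcal S}$ be the laws of $\frac1K\sum_k W_k^{\mathcal O}$ and $\frac1K\sum_k W_k^{\mathcal S}$, and let $\mathcal W_k$ be the union of the supports of $P_k^{\mathcal O}$ and $P_k^{\mathcal S}$. For every client let $f_{D_k}$ be the adversary's prior density of the private data on a space $\mathcal D_k$ with a $\sigma$-finite measure $\mu$, and $f_{D_k|W_k}(\cdot|w)$ his conditional density given model information $w$. Let $F_k^{\mathcal B}$, $F_k^{\mathcal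 O}$, $F_k^{\mathcal A}$ be the distributions with densities $f_{D_k}$, $\int f_{D_k|W_k}(\cdot|w)\,dP_k^{\mathcal O}(w)$ and $\int f_{D_k|W_k}(\cdot|w)\,dP_k^{\mathcal S}(w)$. For distributions with densities $p$, $q$ put $m=(p+q)/2$ and $\mathrm{JS}=\frac12\int p\log\frac pm\,d\mu+\frac12\int q\log\frac qm\,d\mu$. Put $$C_1=\frac1K\sum_{k=1}^K\sqrt{\mathrm{JS}(F_k^{\mathcal O}\|F_k^{\mathcal B})},\qquad \epsilon_p=\frac1K\sum_{k=1}^K\sqrt{\mathrm{JS}(F_k^{\mathcal A}\|F_k^{\mathcal B})},$$ $$\xi=\max_{k}\sup_{w\in\mathcal W_k,\,d\in\mathcal D_k}\left|\log\frac{f_{D_k|W_k}(d|w)}{f_{D_k}(d)}\right|,\qquad C_3=\frac{e^{2\xi}-1}{2},$$ and assume $\xi<\infty$. Let the utility $U(w,d)$ of a model $w$ on a record $d$ satisfy $0\le U(w,d)\le C_4$ for all $w\in\mathcal W_k$, all records $d$ of client $k$ and all $k$. For a random nonempty finite data set $D_k$ (of any law) put $U_k(P)=\mathbb E_{D_k}\mathbb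 E_{w\sim P}\frac1{|D_k|}\sum_{d\in D_k}U(w,d)$ and $\epsilon_u=\frac1K\sum_{k=1}^K[U_k(P_a^{\mathcal O})-U_k(P_a^{\mathcal S})]$. Then $$C_1\le\epsilon_p+C_3\min\Big\{1,\ \sigma_\epsilon^2\sqrt{\textstyle\sum_{i=1}^n\sigma_i^{-4}}\Big\}\qquad\text{and}\qquad \epsilon_u\le C_4\min\Big\{1,\ \sigma_\epsilon^2\sqrt{\textstyle\sum_{i=1}^n\sigma_i^{-4}}\Big\}.$$ -/

import Mathlib

open MeasureTheory ProbabilityTheory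
open scoped ENNReal

noncomputable section

namespace FedTradeoff

/-- `p` is a probability density with respect to the reference measure `μ`. -/
structure IsProbDensity {X : Type*} [MeasurableSpace X] (μ : Measure X) (p : X → ℝ) : Prop where
  measurable : Measurable p
  nonneg : ∀ x, 0 ≤ p x
  lintegral_eq_one : ∫⁻ x, ENNReal.ofReal (p x) ∂μ = 1

/-- Kullback-Leibler divergence `∫ p log (p / q) dμ` of two densities. It is only used with
`q` replaced by the mixture of `p` with another density; there the integrand is integrable for
all probability densities, and the convention `0 * log 0 = 0` is in force. -/
def klDens {X : Type*} [MeasurableSpace X] (μ : Measure X) (p q : X → ℝ) : ℝ :=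
  ∫ x, p x * Real.log (p x / q x) ∂μ

/-- Jensen-Shannon divergence of the distributions with densities `p` and `q`. -/
def jsDens {X : Type*} [MeasurableSpace X] (μ : Measure X) (p q : X → ℝ) : ℝ :=
  (1 / 2) * (klDens μ p (fun x => (p x + q x) / 2) + klDens μ q (fun x => (p x + q x) / 2))

/-- Density `d ↦ ∫ f_{D|W}(d|w) dP(w)` of the adversary's belief about the private data when the
observed model information has law `P`. The conditional density `f_{D|W}(d|w)` is `g d w`. -/
def belief {X E : Type*} [MeasurableSpace E] (g : X → E → ℝ) (P : Measure E) (d : X) : ℝ :=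
  ∫ w, g d w ∂P

/-- Average over the `K` clients of the square root of the Jensen-Shannon divergence. -/
def averageSqrtJS {K : ℕ} {X : Fin K → Type*} [∀ k, MeasurableSpace (X k)]
    (μ : ∀ k, Measure (X k)) (p q : ∀ k, X k → ℝ) : ℝ :=
  (1 / (K : ℝ)) * ∑ k, Real.sqrt (jsDens (μ k) (p k) (q k))

/-- Protected model information: client `k` adds the noise `ε k` to the model information. -/
def protectedInfo {K : ℕ} {Ω E : Type*} [Add E] (W ε : Fin K → Ω → E) (k : Fin K) (ω : Ω) : E :=
  W k ω + ε k ω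

/-- Aggregation: the average of the information uploaded by the clients. -/
def aggregate {K : ℕ} {Ω E : Type*} [AddCommGroup E] [Module ℝ E] (W : Fin K → Ω → E) (ω : Ω) :
    E :=
  (1 / (K : ℝ)) • ∑ k, W k ω

/-- The set `𝒲_k` of model information of client `k`: the union of the supports of the laws of
the protected and of the unprotected information. -/
def infoSet {K : ℕ} {Ω E : Type*} [MeasurableSpace Ω] [TopologicalSpace E] [MeasurableSpace E]
    [Add E] (P : Measure Ω) (W ε : Fin K → Ω → E) (k : Fin K) : Set E :=
  (P.map (protectedInfo W ε k)).support ∪ (P.map (W k)).support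

/-- `sup |log (f_{D|W}(d|w) / f_D(d))|` over `w ∈ S` and all `d`, as an extended nonnegative
number (`log 0 = -∞` and `log ∞ = ∞`, both of absolute value `∞`). -/
def maxLeakage {X E : Type*} (f : X → ℝ) (g : X → E → ℝ) (S : Set E) : ℝ≥0∞ :=
  ⨆ w ∈ S, ⨆ d : X,
    (ENNReal.log (ENNReal.ofReal (g d w) / ENNReal.ofReal (f d))).abs

/-- Nonempty finite data sets of records in `Z`: a size `m + 1` and the tuple of records. -/
abbrev Dataset (Z : Type*) : Type _ := Σ m : ℕ, (Fin (m + 1) → Z)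

/-- Average utility `(1 / |D|) ∑_{z ∈ D} U(w, z)` of the model `w` on the data set `D`. -/
def datasetUtility {E Z : Type*} (U : E → Z → ℝ) (w : E) (D : Dataset Z) : ℝ :=
  (1 / ((D.1 + 1 : ℕ) : ℝ)) * ∑ j, U w (D.2 j)

/-- Expected utility of a model with law `P` on a random data set with law `Q`. -/
def expectedUtility {E Z : Type*} [MeasurableSpace E] [MeasurableSpace Z]
    (U : E → Z → ℝ) (Q : Measure (Dataset Z)) (P : Measure E) : ℝ :=
  ∫ D, ∫ w, datasetUtility U w D ∂P ∂Q

/-- Utility loss: average over the clients of the expected utility with the model law `PO` minus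
that with the model law `PS`. -/
def utilityLoss {K : ℕ} {E : Type*} {Z : Fin K → Type*} [MeasurableSpace E]
    [∀ k, MeasurableSpace (Z k)] (U : ∀ k, E → Z k → ℝ) (Q : ∀ k, Measure (Dataset (Z k)))
    (PO PS : Measure E) : ℝ :=
  (1 / (K : ℝ)) * ∑ k, (expectedUtility (U k) (Q k) PO - expectedUtility (U k) (Q k) PS)

end FedTradeoff

end

/-! Both bounds reduce to one total variation estimate. All laws involved are Gaussian with mean
`μ₀` and diagonal covariance; noise turns the variance `σ i ^ 2` into `σ i ^ 2 + σε ^ 2`, and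
averaging divides both by `K`. The relative increase `σε ^ 2 / σ i ^ 2` is thus the same for one
client and for the average. Cauchy-Schwarz bounds total variation by the Hellinger affinity, which
is a product over coordinates; expanding it gives `T = min 1 (σε ^ 2 * √(∑ 1 / σ i ^ 4))`
(`abs_integral_multivariateGaussian_sub_le`).

Utility: the data set utility takes values in `[0, C₄]`, so its expectation moves by at most `C₄ *
T`.

Privacy: the square root of the Jensen-Shannon divergence satisfies the triangle inequality
(`sqrt_jsDens_triangle`), so only the divergence between the two beliefs must be bounded. Gaussians
with positive variances have full support, so the bound `ξ` on the log-ratio holds for every `w`: `g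
d w` lies between `exp (-ξ) * f d` and `exp ξ * f d`. The beliefs obey the same bounds and differ by
at most `(exp ξ - exp (-ξ)) * T * f d`; a chi-square type bound on the divergence then yields `C₃ *
T` (`sqrt_jsDens_belief_le`). -/

namespace FedTradeoff

/-! ### Jensen-Shannon divergence of two positive numbers -/

/-- Pointwise Jensen-Shannon divergence of two positive numbers. -/
noncomputable def jsPt (x y : ℝ) : ℝ :=
  1 / 2 * (x * Real.log (x / ((x + y) / 2)) + y * Real.log (y / ((x + y) / 2)))

lemma jsPt_comm (x y : ℝ) : jsPt x y = jsPt y x := by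
  unfold jsPt
  rw [add_comm y x, add_comm]

lemma sub_le_mul_log_div {x m : ℝ} (hx : 0 < x) (hm : 0 < m) : x - m ≤ x * Real.log (x / m) := by
  have h := Real.one_sub_inv_le_log_of_pos (div_pos hx hm)
  calc x - m = x * (1 - (x / m)⁻¹) := by field_simp
    _ ≤ _ := by gcongr

lemma mul_log_div_le {x m : ℝ} (hx : 0 < x) (hm : 0 < m) :
    x * Real.log (x / m) ≤ x * (x / m - 1) := by
  have h := Real.log_le_sub_one_of_pos (div_pos hx hm)
  gcongr

lemma jsPt_nonneg {x y : ℝ} (hx : 0 < x) (hy : 0 < y) : 0 ≤ jsPt x y := by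
  have hm : 0 < (x + y) / 2 := by positivity
  have h1 := sub_le_mul_log_div hx hm
  have h2 := sub_le_mul_log_div hy hm
  unfold jsPt
  linarith

/-- From `log t ≤ t - 1`. This quadratic bound makes the divergence of nearby beliefs second order,
so that its square root is linear in the total variation. -/
lemma jsPt_le {x y : ℝ} (hx : 0 < x) (hy : 0 < y) : jsPt x y ≤ (x - y) ^ 2 / (2 * (x + y)) := by
  have hm : 0 < (x + y) / 2 := by positivity
  have h1 := mul_log_div_le hx hm
  have h2 := mul_log_div_le hy hm
  have h3 : (x - y) ^ 2 / (2 * (x + y)) =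
      1 / 2 * (x * (x / ((x + y) / 2) - 1) + y * (y / ((x + y) / 2) - 1)) := by
    field_simp
    ring
  rw [h3]
  unfold jsPt
  linarith

/-- Supplies an integrable majorant for the Jensen-Shannon integrands. -/
lemma abs_mul_log_div_mean_le {x y : ℝ} (hx : 0 < x) (hy : 0 < y) :
    |x * Real.log (x / ((x + y) / 2))| ≤ x + y := by
  have hm : 0 < (x + y) / 2 := by positivity
  have h1 := mul_log_div_le hx hm
  have h2 := sub_le_mul_log_div hx hm
  have h3 : x / ((x + y) / 2) ≤ 2 := by
    rw [div_le_iff₀ hm]; linarith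
  rw [abs_le]
  constructor
  · linarith
  · nlinarith

lemma lintegral_Ioc_of_hasDerivAt {F F' : ℝ → ℝ} {a b : ℝ} (hab : a ≤ b)
    (hF : ∀ x ∈ Set.Icc a b, HasDerivAt F (F' x) x) (hc : ContinuousOn F' (Set.Icc a b))
    (h0 : ∀ x ∈ Set.Icc a b, 0 ≤ F' x) :
    ∫⁻ x in Set.Ioc a b, ENNReal.ofReal (F' x) = ENNReal.ofReal (F b - F a) := by
  have hi : IntervalIntegrable F' volume a b := hc.intervalIntegrable_of_Icc hab
  rw [← intervalIntegral.integral_eq_sub_of_hasDerivAt (f := F) (f' := F')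
    (by rwa [Set.uIcc_of_le hab]) hi, intervalIntegral.integral_of_le hab,
    ofReal_integral_eq_lintegral_ofReal hi.1]
  filter_upwards [ae_restrict_mem measurableSet_Ioc] with x hx
  exact h0 x (Set.Ioc_subset_Icc_self hx)

lemma lintegral_exp_neg_Ioi {c : ℝ} (hc : 0 < c) :
    ∫⁻ s in Set.Ioi (0 : ℝ), ENNReal.ofReal (Real.exp (-(s * c))) = ENNReal.ofReal (1 / c) := by
  have h : ∀ s : ℝ, -(s * c) = -c * s := fun s => by ring
  simp_rw [h]
  rw [← ofReal_integral_eq_lintegral_ofReal, integral_exp_mul_Ioi (by linarith)]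
  · simp
  · exact integrableOn_exp_mul_Ioi (by linarith) 0
  · exact ae_of_all _ fun s => (Real.exp_pos _).le

lemma lintegral_Ioc_inv_add {x y u : ℝ} (hx : 0 < x) (hu : 0 < u) (hxy : x ≤ y) :
    ∫⁻ v in Set.Ioc x y, ENNReal.ofReal (1 / (u + v)) =
      ENNReal.ofReal (Real.log (u + y) - Real.log (u + x)) := by
  refine lintegral_Ioc_of_hasDerivAt (F := fun v => Real.log (u + v)) hxy ?_ ?_ ?_
  · intro v hv
    have : u + v ≠ 0 := by have := hx.trans_le hv.1; positivity
    exact ((hasDerivAt_id v).const_add u).log this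
  · refine ContinuousOn.div (by fun_prop) (by fun_prop) fun v hv => ?_
    have := hx.trans_le hv.1; positivity
  · intro v hv
    have := hx.trans_le hv.1; positivity

lemma lintegral_Ioc_log_sub {x y : ℝ} (hx : 0 < x) (hxy : x ≤ y) :
    ∫⁻ u in Set.Ioc x y, ENNReal.ofReal (Real.log (u + y) - Real.log (u + x)) =
      ENNReal.ofReal (4 * jsPt x y) := by
  have hy : 0 < y := hx.trans_le hxy
  -- With `ψ t = t * log t - t`, an antiderivative of `log`, the right side is the second difference
  -- `ψ (2y) - 2 ψ (x + y) + ψ (2x)`; the linear terms cancel.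
  have key : 4 * jsPt x y =
      (((y + y) * Real.log (y + y) - (y + y)) - ((y + x) * Real.log (y + x) - (y + x)))
      - (((x + y) * Real.log (x + y) - (x + y)) - ((x + x) * Real.log (x + x) - (x + x))) := by
    unfold jsPt
    rw [Real.log_div hx.ne' (by positivity), Real.log_div hy.ne' (by positivity),
      Real.log_div (by positivity) (by norm_num), ← two_mul y, ← two_mul x,
      Real.log_mul (by norm_num) hx.ne', Real.log_mul (by norm_num) hy.ne', add_comm y x]
    ring
  have hd : ∀ t u : ℝ, 0 < u + t →
      HasDerivAt (fun u => (u + t) * Real.log (u + t) - (u + t)) (Real.log (u + t)) u := by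
    intro t u h
    have h1 := (hasDerivAt_id u).add_const t
    have h2 := (h1.mul (h1.log h.ne')).sub h1
    refine h2.congr_deriv ?_
    simp only [id]
    field_simp
    ring
  rw [key]
  refine lintegral_Ioc_of_hasDerivAt (F := fun u => ((u + y) * Real.log (u + y) - (u + y)) -
    ((u + x) * Real.log (u + x) - (u + x))) hxy ?_ ?_ ?_
  · intro u hu
    have := hx.trans_le hu.1
    exact (hd y u (by positivity)).sub (hd x u (by positivity))
  · refine ContinuousOn.sub (ContinuousOn.log (by fun_prop) ?_) (ContinuousOn.log (by fun_prop) ?_)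
    all_goals
      intro u hu
      have := hx.trans_le hu.1
      positivity
  · intro u hu
    have := hx.trans_le hu.1
    have : Real.log (u + x) ≤ Real.log (u + y) :=
      Real.log_le_log (by positivity) (by linarith)
    linarith

lemma lintegral_Ioc_exp_neg {x y s : ℝ} (hs : 0 < s) (hxy : x ≤ y) :
    ∫⁻ u in Set.Ioc x y, ENNReal.ofReal (Real.exp (-(s * u))) =
      ENNReal.ofReal ((Real.exp (-(s * x)) - Real.exp (-(s * y))) / s) := by
  have : (Real.exp (-(s * x)) - Real.exp (-(s * y))) / s =
      -Real.exp (-(s * y)) / s - -Real.exp (-(s * x)) / s := by ring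
  rw [this]
  refine lintegral_Ioc_of_hasDerivAt (F := fun u => -Real.exp (-(s * u)) / s) hxy ?_ ?_ ?_
  · intro u _
    have h := ((((hasDerivAt_id u).const_mul s).neg.exp).neg).div_const s
    refine h.congr_deriv ?_
    simp only [Pi.neg_apply, id]
    field_simp
  · fun_prop
  · intro u _
    positivity

/-- Embeds the positive reals in `L²(0, ∞)` so that `2 * √(jsPt x y)` becomes a norm distance. The
difference quotient is `∫ exp (-s u) du` over `(x, y]`; squaring it, applying Tonelli and
integrating in `s` first leaves the double integral of `1 / (u + v)`, which is `4 * jsPt x y`. -/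
lemma lintegral_sq_expDiff_of_le {x y : ℝ} (hx : 0 < x) (hxy : x ≤ y) :
    ∫⁻ s in Set.Ioi (0 : ℝ),
      ENNReal.ofReal (((Real.exp (-(s * x)) - Real.exp (-(s * y))) / s) ^ 2) =
      ENNReal.ofReal (4 * jsPt x y) := by
  have h1 : ∀ s ∈ Set.Ioi (0 : ℝ),
      ENNReal.ofReal (((Real.exp (-(s * x)) - Real.exp (-(s * y))) / s) ^ 2) =
      ∫⁻ u in Set.Ioc x y, ∫⁻ v in Set.Ioc x y, ENNReal.ofReal (Real.exp (-(s * (u + v)))) := by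
    intro s hs
    have hs : 0 < s := hs
    have h0 : 0 ≤ (Real.exp (-(s * x)) - Real.exp (-(s * y))) / s := by
      refine div_nonneg (sub_nonneg.2 (Real.exp_le_exp.2 ?_)) hs.le
      nlinarith
    have h2 : ∀ u v : ℝ, ENNReal.ofReal (Real.exp (-(s * (u + v)))) =
        ENNReal.ofReal (Real.exp (-(s * u))) * ENNReal.ofReal (Real.exp (-(s * v))) := by
      intro u v
      rw [← ENNReal.ofReal_mul (Real.exp_pos _).le, ← Real.exp_add]
      congr 2; ring
    simp_rw [h2]
    have h3 : ∀ u : ℝ, ∫⁻ v in Set.Ioc x y, ENNReal.ofReal (Real.exp (-(s * u))) *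
        ENNReal.ofReal (Real.exp (-(s * v))) = ENNReal.ofReal (Real.exp (-(s * u))) *
        ENNReal.ofReal ((Real.exp (-(s * x)) - Real.exp (-(s * y))) / s) := by
      intro u
      rw [lintegral_const_mul _ (by fun_prop), lintegral_Ioc_exp_neg hs hxy]
    simp_rw [h3]
    rw [lintegral_mul_const _ (by fun_prop), lintegral_Ioc_exp_neg hs hxy,
      ← ENNReal.ofReal_mul h0, sq]
  rw [setLIntegral_congr_fun measurableSet_Ioi h1, lintegral_lintegral_swap,
    ← lintegral_Ioc_log_sub hx hxy]
  · refine setLIntegral_congr_fun measurableSet_Ioc fun u hu => ?_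
    have hu0 : 0 < u := hx.trans hu.1
    rw [lintegral_lintegral_swap (by unfold Function.uncurry; fun_prop),
      ← lintegral_Ioc_inv_add hx hu0 hxy]
    refine setLIntegral_congr_fun measurableSet_Ioc fun v hv => ?_
    exact lintegral_exp_neg_Ioi (by have := hx.trans hv.1; positivity)
  · refine Measurable.aemeasurable ?_
    have : Measurable (fun q : (ℝ × ℝ) × ℝ =>
        ENNReal.ofReal (Real.exp (-(q.1.1 * (q.1.2 + q.2))))) := by fun_prop
    exact this.lintegral_prod_right'

lemma lintegral_sq_expDiff {x y : ℝ} (hx : 0 < x) (hy : 0 < y) :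
    ∫⁻ s in Set.Ioi (0 : ℝ),
      ENNReal.ofReal (((Real.exp (-(s * x)) - Real.exp (-(s * y))) / s) ^ 2) =
      ENNReal.ofReal (4 * jsPt x y) := by
  rcases le_total x y with h | h
  · exact lintegral_sq_expDiff_of_le hx h
  · rw [jsPt_comm, ← lintegral_sq_expDiff_of_le hy h]
    refine lintegral_congr fun s => ?_
    congr 1; ring

lemma eLpNorm_two_eq {X : Type*} [MeasurableSpace X] (μ : Measure X) (F : X → ℝ) :
    eLpNorm F 2 μ = (∫⁻ x, ENNReal.ofReal (F x ^ 2) ∂μ) ^ (1 / 2 : ℝ) := by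
  rw [eLpNorm_eq_lintegral_rpow_enorm_toReal (by norm_num) (by norm_num)]
  simp only [ENNReal.toReal_ofNat]
  congr 1
  refine lintegral_congr fun x => ?_
  rw [← enorm_norm, Real.enorm_eq_ofReal (norm_nonneg _), ENNReal.ofReal_rpow_of_nonneg
    (norm_nonneg _) (by norm_num)]
  congr 1
  norm_num

lemma eLpNorm_expDiff {x y : ℝ} (hx : 0 < x) (hy : 0 < y) :
    eLpNorm (fun s => (Real.exp (-(s * x)) - Real.exp (-(s * y))) / s) 2
      (volume.restrict (Set.Ioi 0)) = ENNReal.ofReal (2 * Real.sqrt (jsPt x y)) := by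
  have h4 : (2 : ℝ) = Real.sqrt 4 := by
    rw [show (4 : ℝ) = 2 ^ 2 by norm_num, Real.sqrt_sq (by norm_num)]
  rw [eLpNorm_two_eq, lintegral_sq_expDiff hx hy, ENNReal.ofReal_rpow_of_nonneg
    (mul_nonneg (by norm_num) (jsPt_nonneg hx hy)) (by norm_num), ← Real.sqrt_eq_rpow,
    Real.sqrt_mul (by norm_num), ← h4]

/-- The square root of the pointwise Jensen-Shannon divergence satisfies the triangle
inequality. -/
lemma sqrt_jsPt_triangle {x y z : ℝ} (hx : 0 < x) (hy : 0 < y) (hz : 0 < z) :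
    Real.sqrt (jsPt x z) ≤ Real.sqrt (jsPt x y) + Real.sqrt (jsPt y z) := by
  have hm : ∀ a b : ℝ, AEStronglyMeasurable
      (fun s : ℝ => (Real.exp (-(s * a)) - Real.exp (-(s * b))) / s)
      (volume.restrict (Set.Ioi 0)) := fun a b =>
    Measurable.aestronglyMeasurable (by fun_prop)
  -- Minkowski's inequality for the embedded points; the two differences telescope.
  have h := eLpNorm_add_le (hm x y) (hm y z) (p := 2) (by norm_num)
  have he : ((fun s : ℝ => (Real.exp (-(s * x)) - Real.exp (-(s * y))) / s) +
      fun s : ℝ => (Real.exp (-(s * y)) - Real.exp (-(s * z))) / s) =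
      fun s : ℝ => (Real.exp (-(s * x)) - Real.exp (-(s * z))) / s := by
    funext s
    simp only [Pi.add_apply]
    ring
  rw [he, eLpNorm_expDiff hx hy, eLpNorm_expDiff hy hz, eLpNorm_expDiff hx hz,
    ← ENNReal.ofReal_add (by positivity) (by positivity),
    ENNReal.ofReal_le_ofReal_iff (by positivity)] at h
  linarith

/-! ### Jensen-Shannon divergence of positive densities -/

section Densities

variable {X : Type*} [MeasurableSpace X] {μ : Measure X} {p q r : X → ℝ}

lemma integrable_mul_log_div_mean (hpm : Measurable p) (hqm : Measurable q)
    (hp : ∀ x, 0 < p x) (hq : ∀ x, 0 < q x) (hpi : Integrable p μ) (hqi : Integrable q μ) :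
    Integrable (fun x => p x * Real.log (p x / ((p x + q x) / 2))) μ :=
  (hpi.add hqi).mono' (Measurable.aestronglyMeasurable (by fun_prop))
    (ae_of_all _ fun x => abs_mul_log_div_mean_le (hp x) (hq x))

lemma integrable_jsPt (hpm : Measurable p) (hqm : Measurable q)
    (hp : ∀ x, 0 < p x) (hq : ∀ x, 0 < q x) (hpi : Integrable p μ) (hqi : Integrable q μ) :
    Integrable (fun x => jsPt (p x) (q x)) μ := by
  have h1 := integrable_mul_log_div_mean hpm hqm hp hq hpi hqi
  have h2 := integrable_mul_log_div_mean hqm hpm hq hp hqi hpi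
  simp_rw [add_comm (q _) (p _)] at h2
  exact (h1.add h2).const_mul (1 / 2)

lemma jsDens_eq_integral_jsPt (hpm : Measurable p) (hqm : Measurable q)
    (hp : ∀ x, 0 < p x) (hq : ∀ x, 0 < q x) (hpi : Integrable p μ) (hqi : Integrable q μ) :
    jsDens μ p q = ∫ x, jsPt (p x) (q x) ∂μ := by
  have h1 := integrable_mul_log_div_mean hpm hqm hp hq hpi hqi
  have h2 := integrable_mul_log_div_mean hqm hpm hq hp hqi hpi
  simp_rw [add_comm (q _) (p _)] at h2
  unfold jsDens klDens jsPt
  rw [← integral_add h1 h2, integral_const_mul]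

lemma eLpNorm_sqrt_jsPt (hpm : Measurable p) (hqm : Measurable q)
    (hp : ∀ x, 0 < p x) (hq : ∀ x, 0 < q x) (hpi : Integrable p μ) (hqi : Integrable q μ) :
    eLpNorm (fun x => Real.sqrt (jsPt (p x) (q x))) 2 μ =
      ENNReal.ofReal (Real.sqrt (jsDens μ p q)) := by
  rw [eLpNorm_two_eq, jsDens_eq_integral_jsPt hpm hqm hp hq hpi hqi]
  have h0 : ∀ x, 0 ≤ jsPt (p x) (q x) := fun x => jsPt_nonneg (hp x) (hq x)
  simp_rw [Real.sq_sqrt (h0 _)]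
  rw [← ofReal_integral_eq_lintegral_ofReal (integrable_jsPt hpm hqm hp hq hpi hqi)
    (ae_of_all _ h0), ENNReal.ofReal_rpow_of_nonneg (integral_nonneg h0) (by norm_num),
    ← Real.sqrt_eq_rpow]

/-- The square root of the Jensen-Shannon divergence satisfies the triangle inequality. -/
lemma sqrt_jsDens_triangle (hpm : Measurable p) (hqm : Measurable q) (hrm : Measurable r)
    (hp : ∀ x, 0 < p x) (hq : ∀ x, 0 < q x) (hr : ∀ x, 0 < r x)
    (hpi : Integrable p μ) (hqi : Integrable q μ) (hri : Integrable r μ) :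
    Real.sqrt (jsDens μ p r) ≤ Real.sqrt (jsDens μ p q) + Real.sqrt (jsDens μ q r) := by
  have hm : ∀ {a b : X → ℝ}, Measurable a → Measurable b →
      AEStronglyMeasurable (fun x => Real.sqrt (jsPt (a x) (b x))) μ := by
    intro a b ha hb
    unfold jsPt
    exact Measurable.aestronglyMeasurable (by fun_prop)
  -- A second use of Minkowski, now in `L²(μ)`, integrates the pointwise triangle inequality.
  have h := eLpNorm_add_le (hm hpm hqm) (hm hqm hrm) (p := 2) (by norm_num)
  have h' : eLpNorm (fun x => Real.sqrt (jsPt (p x) (r x))) 2 μ ≤ _ :=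
    (eLpNorm_mono_real (fun x => by
    rw [Real.norm_of_nonneg (Real.sqrt_nonneg _)]
    exact sqrt_jsPt_triangle (hp x) (hq x) (hr x))).trans h
  rw [eLpNorm_sqrt_jsPt hpm hqm hp hq hpi hqi, eLpNorm_sqrt_jsPt hqm hrm hq hr hqi hri,
    eLpNorm_sqrt_jsPt hpm hrm hp hr hpi hri,
    ← ENNReal.ofReal_add (by positivity) (by positivity),
    ENNReal.ofReal_le_ofReal_iff (by positivity)] at h'
  exact h'

/-- If `p` and `q` are at least `c f` and differ by at most `b f`, for a probability density `f`,
then the Jensen-Shannon divergence is at most `b² / (4 c)`. -/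
lemma jsDens_le_of_abs_sub_le {f : X → ℝ} {b c : ℝ} (hc : 0 < c) (hf : ∀ x, 0 < f x)
    (hfi : Integrable f μ) (hf1 : ∫ x, f x ∂μ = 1)
    (hpm : Measurable p) (hqm : Measurable q) (hpi : Integrable p μ) (hqi : Integrable q μ)
    (hp : ∀ x, c * f x ≤ p x) (hq : ∀ x, c * f x ≤ q x)
    (hpq : ∀ x, |p x - q x| ≤ b * f x) :
    jsDens μ p q ≤ b ^ 2 / (4 * c) := by
  have hp0 : ∀ x, 0 < p x := fun x => (mul_pos hc (hf x)).trans_le (hp x)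
  have hq0 : ∀ x, 0 < q x := fun x => (mul_pos hc (hf x)).trans_le (hq x)
  rw [jsDens_eq_integral_jsPt hpm hqm hp0 hq0 hpi hqi]
  calc ∫ x, jsPt (p x) (q x) ∂μ ≤ ∫ x, b ^ 2 / (4 * c) * f x ∂μ := by
        refine integral_mono (integrable_jsPt hpm hqm hp0 hq0 hpi hqi) (hfi.const_mul _) fun x => ?_
        refine (jsPt_le (hp0 x) (hq0 x)).trans ?_
        have h1 : (p x - q x) ^ 2 ≤ (b * f x) ^ 2 := sq_le_sq' (neg_le_of_abs_le (hpq x))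
          (le_of_abs_le (hpq x))
        have h2 := hp x
        have h3 := hq x
        have hfx := hf x
        calc (p x - q x) ^ 2 / (2 * (p x + q x)) ≤ (b * f x) ^ 2 / (4 * (c * f x)) := by
              apply div_le_div₀ (by positivity) h1 (by positivity)
              linarith
          _ = b ^ 2 / (4 * c) * f x := by field_simp
    _ = _ := by rw [integral_const_mul, hf1, mul_one]

end Densities

/-! ### Hellinger affinity and total variation of Gaussian products -/

/-- Bound of the difference of two expectations by the Hellinger affinity of the densities. -/
lemma abs_integral_mul_sub_le {X : Type*} [MeasurableSpace X] {ν : Measure X} {p q h : X → ℝ}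
    (hpm : Measurable p) (hqm : Measurable q)
    (hp : ∀ x, 0 ≤ p x) (hq : ∀ x, 0 ≤ q x) (hpi : Integrable p ν) (hqi : Integrable q ν)
    (hp1 : ∫ x, p x ∂ν = 1) (hq1 : ∫ x, q x ∂ν = 1) {c : ℝ}
    (hh : ∀ x, |h x| ≤ c) :
    |∫ x, h x * (p x - q x) ∂ν| ≤
      c * (2 * Real.sqrt (2 - 2 * ∫ x, Real.sqrt (p x) * Real.sqrt (q x) ∂ν)) := by
  -- A point of `X` is needed for `0 ≤ c`; an empty space cannot carry integral `1`.
  rcases isEmpty_or_nonempty X with hX | ⟨⟨x₀⟩⟩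
  · simp [Measure.eq_zero_of_isEmpty ν] at hp1
  have hc : 0 ≤ c := (abs_nonneg _).trans (hh x₀)
  set A : X → ℝ := fun x => |Real.sqrt (p x) - Real.sqrt (q x)| with hA
  set B : X → ℝ := fun x => Real.sqrt (p x) + Real.sqrt (q x) with hB
  have hs : Integrable (fun x => Real.sqrt (p x) * Real.sqrt (q x)) ν := by
    refine (hpi.add hqi).mono' (Measurable.aestronglyMeasurable (by fun_prop))
      (ae_of_all _ fun x => ?_)
    rw [Real.norm_of_nonneg (by positivity), Pi.add_apply]
    nlinarith [Real.sq_sqrt (hp x), Real.sq_sqrt (hq x),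
      sq_nonneg (Real.sqrt (p x) - Real.sqrt (q x)), hp x, hq x]
  have hpqi : Integrable (fun x => p x + q x) ν := hpi.add hqi
  have hA2 : ∀ x, A x ^ (2 : ℝ) = p x + q x - 2 * (Real.sqrt (p x) * Real.sqrt (q x)) := by
    intro x
    rw [Real.rpow_two, hA, sq_abs, sub_sq, Real.sq_sqrt (hp x), Real.sq_sqrt (hq x)]
    ring
  have hB2 : ∀ x, B x ^ (2 : ℝ) = p x + q x + 2 * (Real.sqrt (p x) * Real.sqrt (q x)) := by
    intro x
    rw [Real.rpow_two, hB, add_sq, Real.sq_sqrt (hp x), Real.sq_sqrt (hq x)]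
    ring
  have hAm : Measurable A := by
    have : Measurable fun x => Real.sqrt (p x) - Real.sqrt (q x) := by fun_prop
    exact this.norm
  have hBm : Measurable B := by fun_prop
  have hA0 : ∀ x, 0 ≤ A x := fun x => abs_nonneg _
  have hB0 : ∀ x, 0 ≤ B x := fun x => by positivity
  have hAL : MemLp A (ENNReal.ofReal 2) ν := by
    rw [show ENNReal.ofReal 2 = 2 by norm_num, memLp_two_iff_integrable_sq hAm.aestronglyMeasurable]
    simp_rw [← Real.rpow_two, hA2]
    exact hpqi.sub (hs.const_mul 2)
  have hBL : MemLp B (ENNReal.ofReal 2) ν := by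
    rw [show ENNReal.ofReal 2 = 2 by norm_num, memLp_two_iff_integrable_sq hBm.aestronglyMeasurable]
    simp_rw [← Real.rpow_two, hB2]
    exact hpqi.add (hs.const_mul 2)
  have hAB : ∀ x, A x * B x = |p x - q x| := by
    intro x
    rw [← abs_of_nonneg (hB0 x), hA, hB, ← abs_mul]
    congr 1
    nlinarith [Real.sq_sqrt (hp x), Real.sq_sqrt (hq x)]
  -- Cauchy-Schwarz for `|p - q| = |√p - √q| * (√p + √q)`: the squared norms of the factors are `2 -
  -- 2β` and `2 + 2β ≤ 4`.
  have hCS := integral_mul_le_Lp_mul_Lq_of_nonneg Real.HolderConjugate.two_two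
    (ae_of_all ν hA0) (ae_of_all ν hB0) hAL hBL
  simp_rw [hAB, hA2, hB2] at hCS
  rw [integral_sub hpqi (hs.const_mul 2), integral_add hpqi (hs.const_mul 2),
    integral_add hpi hqi, hp1, hq1, integral_const_mul, ← Real.sqrt_eq_rpow,
    ← Real.sqrt_eq_rpow] at hCS
  set β := ∫ x, Real.sqrt (p x) * Real.sqrt (q x) ∂ν with hβ
  have hβ1 : β ≤ 1 := by
    have h0 : 0 ≤ ∫ x, A x ^ (2 : ℝ) ∂ν := integral_nonneg fun x => Real.rpow_nonneg (hA0 x) _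
    simp_rw [hA2] at h0
    rw [integral_sub hpqi (hs.const_mul 2), integral_add hpi hqi, hp1, hq1,
      integral_const_mul] at h0
    linarith
  have h4 : Real.sqrt (1 + 1 + 2 * β) ≤ 2 := by
    rw [Real.sqrt_le_left (by norm_num)]; linarith
  calc |∫ x, h x * (p x - q x) ∂ν| ≤ ∫ x, |h x * (p x - q x)| ∂ν := abs_integral_le_integral_abs
    _ ≤ ∫ x, c * |p x - q x| ∂ν := by
        refine integral_mono_of_nonneg (ae_of_all _ fun x => abs_nonneg _)
          ((hpi.sub hqi).abs.const_mul c) (ae_of_all _ fun x => ?_)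
        simp only [abs_mul]
        exact mul_le_mul_of_nonneg_right (hh x) (abs_nonneg _)
    _ = c * ∫ x, |p x - q x| ∂ν := integral_const_mul _ _
    _ ≤ c * (2 * Real.sqrt (2 - 2 * β)) := by
        refine mul_le_mul_of_nonneg_left (hCS.trans ?_) hc
        rw [mul_comm, show (1 : ℝ) + 1 - 2 * β = 2 - 2 * β by ring]
        gcongr

/-- A union bound: it turns the product of coordinate affinities into a sum of coordinate defects.
-/
lemma one_sub_prod_le_sum {ι : Type*} (s : Finset ι) (β : ι → ℝ) (h0 : ∀ i, 0 ≤ β i)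
    (h1 : ∀ i, β i ≤ 1) : 1 - ∏ i ∈ s, β i ≤ ∑ i ∈ s, (1 - β i) := by
  classical
  induction s using Finset.induction_on with
  | empty => simp
  | insert a s ha ih =>
    rw [Finset.prod_insert ha, Finset.sum_insert ha]
    have hP : ∏ i ∈ s, β i ≤ 1 := Finset.prod_le_one (fun i _ => h0 i) fun i _ => h1 i
    nlinarith [h0 a, h1 a]

/-- Hellinger affinity of two normal distributions with equal means. -/
lemma integral_sqrt_gaussianPDFReal_mul (m : ℝ) {v w : NNReal} (hv : v ≠ 0) (hw : w ≠ 0) :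
    ∫ x, Real.sqrt (gaussianPDFReal m v x) * Real.sqrt (gaussianPDFReal m w x) =
      Real.sqrt (2 * (Real.sqrt v * Real.sqrt w) / (v + w)) := by
  have hv' : (0 : ℝ) < v := by positivity
  have hw' : (0 : ℝ) < w := by positivity
  have hpi := Real.pi_pos
  -- Half the sum of the exponent rates `1 / (2v)` and `1 / (2w)`, because of the square root.
  set b : ℝ := (v + w) / (4 * v * w) with hb
  have h1 : ∀ x, Real.sqrt (gaussianPDFReal m v x) * Real.sqrt (gaussianPDFReal m w x) =
      Real.sqrt ((2 * Real.pi * (Real.sqrt v * Real.sqrt w))⁻¹) *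
        Real.exp (-b * (x - m) ^ 2) := by
    intro x
    rw [← Real.sqrt_mul (gaussianPDFReal_nonneg _ _ _), gaussianPDFReal, gaussianPDFReal]
    have e1 : Real.exp (-b * (x - m) ^ 2) = Real.sqrt (Real.exp (-b * (x - m) ^ 2) ^ 2) :=
      (Real.sqrt_sq (Real.exp_pos _).le).symm
    rw [e1, ← Real.sqrt_mul (by positivity), ← Real.exp_nat_mul]
    congr 1
    have e2 : Real.exp (((2 : ℕ) : ℝ) * (-b * (x - m) ^ 2)) =
        Real.exp (-(x - m) ^ 2 / (2 * v)) * Real.exp (-(x - m) ^ 2 / (2 * w)) := by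
      rw [← Real.exp_add]
      congr 1
      rw [hb]
      push_cast
      field_simp
      ring
    rw [e2, Real.sqrt_mul (by positivity), Real.sqrt_mul (x := 2 * Real.pi) (by positivity)]
    have e3 : (Real.sqrt (2 * Real.pi))⁻¹ * (Real.sqrt (2 * Real.pi))⁻¹ = (2 * Real.pi)⁻¹ := by
      rw [← mul_inv, Real.mul_self_sqrt (by positivity)]
    rw [mul_inv (Real.sqrt (2 * Real.pi)) (Real.sqrt v),
      mul_inv (Real.sqrt (2 * Real.pi)) (Real.sqrt w), mul_inv (2 * Real.pi), ← e3]
    ring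
  simp_rw [h1]
  rw [integral_const_mul, integral_sub_right_eq_self (fun x => Real.exp (-b * x ^ 2)) m,
    integral_gaussian, ← Real.sqrt_mul (by positivity)]
  congr 1
  have e4 : (v : ℝ) = Real.sqrt v * Real.sqrt v := (Real.mul_self_sqrt hv'.le).symm
  have e5 : (w : ℝ) = Real.sqrt w * Real.sqrt w := (Real.mul_self_sqrt hw'.le).symm
  have sv : 0 < Real.sqrt v := Real.sqrt_pos.2 hv'
  have sw : 0 < Real.sqrt w := Real.sqrt_pos.2 hw'
  rw [hb]
  generalize Real.sqrt v = a at *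
  generalize Real.sqrt w = c at *
  rw [e4, e5]
  field_simp
  norm_num

lemma gaussian_affinity_bounds {v w : ℝ} (hv : 0 < v) (hvw : v ≤ w) :
    Real.sqrt (2 * (Real.sqrt v * Real.sqrt w) / (v + w)) ≤ 1 ∧
    1 - Real.sqrt (2 * (Real.sqrt v * Real.sqrt w) / (v + w)) ≤ ((w - v) / v) ^ 2 / 8 := by
  have hw : 0 < w := hv.trans_le hvw
  set a := Real.sqrt v with ha
  set c := Real.sqrt w with hc
  have sv : 0 < a := Real.sqrt_pos.2 hv
  have hac : a ≤ c := Real.sqrt_le_sqrt hvw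
  have sw : 0 < c := Real.sqrt_pos.2 hw
  have e4 : v = a ^ 2 := (Real.sq_sqrt hv.le).symm
  have e5 : w = c ^ 2 := (Real.sq_sqrt hw.le).symm
  set t := 2 * (a * c) / (v + w) with ht
  have ht0 : 0 ≤ t := by positivity
  have ht1 : t ≤ 1 := by
    rw [ht, div_le_one (by positivity), e4, e5]
    nlinarith [sq_nonneg (a - c)]
  -- Since `t ≤ 1`, the defect `1 - √t` is at most the rational expression `1 - t`.
  have hst : t ≤ Real.sqrt t := by
    apply Real.le_sqrt_of_sq_le
    nlinarith
  refine ⟨Real.sqrt_le_one.2 ht1, ?_⟩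
  have h1 : 1 - t = (c - a) ^ 2 / (c ^ 2 + a ^ 2) := by
    rw [ht, e4, e5]; field_simp; ring
  have h2 : (w - v) / v = (c - a) * (c + a) / a ^ 2 := by
    rw [e4, e5]; ring
  have h3 : 1 - t ≤ ((w - v) / v) ^ 2 / 8 := by
    rw [h1, h2]
    have : ((c - a) * (c + a) / a ^ 2) ^ 2 / 8 = (c - a) ^ 2 * ((c + a) ^ 2 / (8 * a ^ 4)) := by
      field_simp
    rw [this, div_eq_mul_one_div]
    refine mul_le_mul_of_nonneg_left ?_ (sq_nonneg _)
    rw [div_le_div_iff₀ (by positivity) (by positivity)]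
    -- The constant `8` arises here: `c ≥ a` gives `(c + a)² (c² + a²) ≥ 4a² * 2a²`.
    have g1 : (2 * a) ^ 2 ≤ (c + a) ^ 2 := by gcongr; linarith
    have g2 : 2 * a ^ 2 ≤ c ^ 2 + a ^ 2 := by nlinarith
    have : (2 * a) ^ 2 * (2 * a ^ 2) ≤ (c + a) ^ 2 * (c ^ 2 + a ^ 2) := by gcongr
    nlinarith
  linarith

lemma pi_withDensity_ofReal {n : ℕ} (p : Fin n → ℝ → ℝ)
    (h0 : ∀ i x, 0 ≤ p i x) (hi : ∀ i, Integrable (p i)) :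
    Measure.pi (fun i => (volume : Measure ℝ).withDensity fun x => ENNReal.ofReal (p i x)) =
      (volume : Measure (Fin n → ℝ)).withDensity
        fun x => ENNReal.ofReal (∏ i, p i (x i)) := by
  have : ∀ i, IsFiniteMeasure ((volume : Measure ℝ).withDensity fun x => ENNReal.ofReal (p i x)) :=
    fun i => isFiniteMeasure_withDensity_ofReal (hi i).2
  refine Measure.pi_eq fun s hs => ?_
  rw [withDensity_apply _ (MeasurableSet.univ_pi hs), volume_pi, Measure.restrict_pi_pi,
    ← ofReal_integral_eq_lintegral_ofReal (Integrable.fintype_prod fun i => (hi i).restrict)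
      (ae_of_all _ fun x => Finset.prod_nonneg fun i _ => h0 i _),
    integral_fintype_prod_eq_prod, ENNReal.ofReal_prod_of_nonneg
      fun i _ => integral_nonneg fun x => h0 i x]
  refine Finset.prod_congr rfl fun i _ => ?_
  rw [withDensity_apply _ (hs i), ofReal_integral_eq_lintegral_ofReal (hi i).restrict
    (ae_of_all _ (h0 i))]

lemma pi_gaussianReal_eq_withDensity {n : ℕ} (m : Fin n → ℝ) (v : Fin n → NNReal)
    (hv : ∀ i, v i ≠ 0) :
    Measure.pi (fun i => gaussianReal (m i) (v i)) =
      volume.withDensity fun x => ENNReal.ofReal (∏ i, gaussianPDFReal (m i) (v i) (x i)) := by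
  rw [← pi_withDensity_ofReal _
    (fun i => gaussianPDFReal_nonneg _ _) fun i => integrable_gaussianPDFReal _ _]
  congr 1
  funext i
  rw [gaussianReal_of_var_ne_zero _ (hv i)]
  rfl

/-- Total variation bound for two products of normal distributions with equal means. -/
lemma abs_integral_pi_gaussianReal_sub_le {n : ℕ} (m : Fin n → ℝ) (v w : Fin n → NNReal)
    (hv : ∀ i, v i ≠ 0) (hvw : ∀ i, v i ≤ w i) {h : (Fin n → ℝ) → ℝ} (hm : Measurable h) {c : ℝ}
    (hh : ∀ x, |h x| ≤ c) :
    |∫ x, h x ∂Measure.pi (fun i => gaussianReal (m i) (v i)) -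
      ∫ x, h x ∂Measure.pi (fun i => gaussianReal (m i) (w i))| ≤
      c * Real.sqrt (∑ i, (((w i : ℝ) - v i) / v i) ^ 2) := by
  have hw : ∀ i, w i ≠ 0 := fun i => ((pos_iff_ne_zero.2 (hv i)).trans_le (hvw i)).ne'
  have hc : 0 ≤ c := (abs_nonneg _).trans (hh 0)
  set d : (Fin n → NNReal) → (Fin n → ℝ) → ℝ :=
    fun u x => ∏ i, gaussianPDFReal (m i) (u i) (x i) with hd
  have hdm : ∀ u, Measurable (d u) := fun u =>
    Finset.measurable_prod _ fun i _ =>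
      (measurable_gaussianPDFReal _ _).comp (measurable_pi_apply i)
  have hd0 : ∀ u x, 0 ≤ d u x := fun u x =>
    Finset.prod_nonneg fun i _ => gaussianPDFReal_nonneg _ _ _
  have hdi : ∀ u, Integrable (d u) := fun u =>
    Integrable.fintype_prod fun i => integrable_gaussianPDFReal _ _
  have hd1 : ∀ u, (∀ i, u i ≠ 0) → ∫ x, d u x = 1 := by
    intro u hu
    rw [hd]
    simp only
    rw [integral_fintype_prod_volume_eq_prod]
    exact Finset.prod_eq_one fun i _ => integral_gaussianPDFReal_eq_one _ (hu i)
  have hint : ∀ u, (∀ i, u i ≠ 0) → ∫ x, h x ∂Measure.pi (fun i => gaussianReal (m i) (u i)) =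
      ∫ x, h x * d u x := by
    intro u hu
    rw [pi_gaussianReal_eq_withDensity m u hu,
      integral_withDensity_eq_integral_toReal_smul₀ (by
        exact ((hdm u).ennreal_ofReal).aemeasurable) (ae_of_all _ fun x => ENNReal.ofReal_lt_top)]
    refine integral_congr_ae (ae_of_all _ fun x => ?_)
    simp only [smul_eq_mul]
    rw [ENNReal.toReal_ofReal (hd0 u x), mul_comm]
  have hhi : ∀ u, Integrable (fun x => h x * d u x) := fun u =>
    (hdi u).bdd_mul hm.aestronglyMeasurable (ae_of_all _ hh)
  rw [hint v hv, hint w hw, ← integral_sub (hhi v) (hhi w)]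
  simp_rw [← mul_sub]
  refine (abs_integral_mul_sub_le (hdm v) (hdm w) (hd0 v) (hd0 w) (hdi v) (hdi w) (hd1 v hv)
    (hd1 w hw) hh).trans (mul_le_mul_of_nonneg_left ?_ hc)
  have haff : ∫ x, Real.sqrt (d v x) * Real.sqrt (d w x) =
      ∏ i, Real.sqrt (2 * (Real.sqrt (v i) * Real.sqrt (w i)) / (v i + w i)) := by
    have : ∀ x, Real.sqrt (d v x) * Real.sqrt (d w x) =
        ∏ i, Real.sqrt (gaussianPDFReal (m i) (v i) (x i)) *
          Real.sqrt (gaussianPDFReal (m i) (w i) (x i)) := by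
      intro x
      rw [Finset.prod_mul_distrib, hd, Real.sqrt_prod _ fun i _ => gaussianPDFReal_nonneg _ _ _,
        Real.sqrt_prod _ fun i _ => gaussianPDFReal_nonneg _ _ _]
    simp_rw [this]
    rw [integral_fintype_prod_volume_eq_prod (f := fun i y =>
      Real.sqrt (gaussianPDFReal (m i) (v i) y) * Real.sqrt (gaussianPDFReal (m i) (w i) y))]
    exact Finset.prod_congr rfl fun i _ => integral_sqrt_gaussianPDFReal_mul _ (hv i) (hw i)
  rw [haff]
  have hb : ∀ i, _ := fun i => gaussian_affinity_bounds (v := v i) (w := w i)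
    (by have := hv i; positivity) (by exact_mod_cast hvw i)
  have hs := one_sub_prod_le_sum Finset.univ
    (fun i => Real.sqrt (2 * (Real.sqrt (v i) * Real.sqrt (w i)) / (v i + w i)))
    (fun i => Real.sqrt_nonneg _) fun i => (hb i).1
  have hs2 := hs.trans (Finset.sum_le_sum fun i _ => (hb i).2)
  rw [← Finset.sum_div] at hs2
  have h2 : (2 : ℝ) = Real.sqrt 4 := by
    rw [show (4 : ℝ) = 2 ^ 2 by norm_num, Real.sqrt_sq (by norm_num)]
  -- `2 * √(2 - 2β) = √(8 (1 - β))`, and this `8` cancels the one in the coordinate bound.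
  conv_lhs => rw [h2, ← Real.sqrt_mul (by norm_num), ← h2]
  apply Real.sqrt_le_sqrt
  linarith

/-! ### Multivariate normal laws with diagonal covariance -/

section Gaussian

variable {n : ℕ}

lemma charFun_multivariateGaussian_diagonal (m : EuclideanSpace ℝ (Fin n)) {v : Fin n → ℝ}
    (hv : ∀ i, 0 ≤ v i) (t : EuclideanSpace ℝ (Fin n)) :
    charFun (multivariateGaussian m (Matrix.diagonal v)) t =
      Complex.exp (∑ i, ((t i : ℂ) * (m i : ℂ) * Complex.I - (v i : ℂ) * (t i : ℂ) ^ 2 / 2)) := by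
  rw [charFun_multivariateGaussian (Matrix.PosSemidef.diagonal hv), Finset.sum_sub_distrib,
    ← Finset.sum_mul, ← Finset.sum_div, PiLp.inner_apply]
  simp only [dotProduct, Matrix.mulVec_diagonal]
  push_cast
  congr 3
  · simp [mul_comm]
  · exact Finset.sum_congr rfl fun i _ => by ring

/-- The characteristic functions agree. The product form makes coordinatewise densities and
affinities available. -/
lemma multivariateGaussian_diagonal_eq_map_pi (m : EuclideanSpace ℝ (Fin n)) {v : Fin n → ℝ}
    (hv : ∀ i, 0 ≤ v i) :
    multivariateGaussian m (Matrix.diagonal v) =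
      (Measure.pi fun i => gaussianReal (m i) (v i).toNNReal).map
        (MeasurableEquiv.toLp 2 (Fin n → ℝ)) := by
  have : IsProbabilityMeasure ((Measure.pi fun i => gaussianReal (m i) (v i).toNNReal).map
      (MeasurableEquiv.toLp 2 (Fin n → ℝ))) :=
    Measure.isProbabilityMeasure_map (MeasurableEquiv.measurable _).aemeasurable
  apply Measure.ext_of_charFun (E := EuclideanSpace ℝ (Fin n))
  ext t
  rw [charFun_multivariateGaussian_diagonal m hv, MeasurableEquiv.coe_toLp, charFun_pi,
    Complex.exp_sum]
  refine Finset.prod_congr rfl fun i _ => ?_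
  rw [charFun_gaussianReal, Real.coe_toNNReal _ (hv i)]

lemma support_multivariateGaussian_diagonal (m : EuclideanSpace ℝ (Fin n)) {v : Fin n → ℝ}
    (hv : ∀ i, 0 < v i) :
    (multivariateGaussian m (Matrix.diagonal v)).support = Set.univ := by
  rw [multivariateGaussian_diagonal_eq_map_pi m fun i => (hv i).le]
  have h1 : ∀ i, (gaussianReal (m i) (v i).toNNReal).IsOpenPosMeasure := fun i =>
    (gaussianReal_absolutelyContinuous' _ (Real.toNNReal_pos.2 (hv i)).ne').isOpenPosMeasure
  have h2 : ((Measure.pi fun i => gaussianReal (m i) (v i).toNNReal).map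
      (MeasurableEquiv.toLp 2 (Fin n → ℝ))).IsOpenPosMeasure :=
    (PiLp.continuous_toLp 2 fun _ : Fin n => ℝ).isOpenPosMeasure_map
      (MeasurableEquiv.toLp 2 (Fin n → ℝ)).surjective
  exact Measure.support_eq_univ

/-- Total variation bound for two normal distributions with equal means and diagonal covariance
matrices. -/
lemma abs_integral_multivariateGaussian_sub_le (m : EuclideanSpace ℝ (Fin n)) {v w : Fin n → ℝ}
    (hv : ∀ i, 0 < v i) (hvw : ∀ i, v i ≤ w i) {h : EuclideanSpace ℝ (Fin n) → ℝ}
    (hm : Measurable h) {a b : ℝ} (ha : ∀ x, a ≤ h x) (hb : ∀ x, h x ≤ b) :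
    |∫ x, h x ∂multivariateGaussian m (Matrix.diagonal v) -
      ∫ x, h x ∂multivariateGaussian m (Matrix.diagonal w)| ≤
      (b - a) * min 1 (Real.sqrt (∑ i, ((w i - v i) / v i) ^ 2)) := by
  have hw : ∀ i, 0 < w i := fun i => (hv i).trans_le (hvw i)
  have hab : 0 ≤ b - a := sub_nonneg.2 ((ha 0).trans (hb 0))
  have hint : ∀ (ν : Measure (EuclideanSpace ℝ (Fin n))) [IsProbabilityMeasure ν],
      Integrable h ν := fun ν _ => by
    refine Integrable.of_bound hm.aestronglyMeasurable (max |a| |b|) (ae_of_all _ fun x => ?_)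
    exact abs_le_max_abs_abs (ha x) (hb x)
  have hmem : ∀ (ν : Measure (EuclideanSpace ℝ (Fin n))) [IsProbabilityMeasure ν],
      a ≤ ∫ x, h x ∂ν ∧ ∫ x, h x ∂ν ≤ b := fun ν _ => by
    constructor
    · simpa using integral_mono (integrable_const a) (hint ν) ha
    · simpa using integral_mono (hint ν) (integrable_const b) hb
  rw [mul_min_of_nonneg _ _ hab, mul_one]
  refine le_min ?_ ?_
  · have h1 := hmem (multivariateGaussian m (Matrix.diagonal v))
    have h2 := hmem (multivariateGaussian m (Matrix.diagonal w))
    rw [abs_le]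
    constructor <;> linarith [h1.1, h1.2, h2.1, h2.2]
  · have hsub : ∀ (ν : Measure (EuclideanSpace ℝ (Fin n))) [IsProbabilityMeasure ν],
        ∫ x, (h x - a) ∂ν = ∫ x, h x ∂ν - a := fun ν _ => by
      rw [integral_sub (hint ν) (integrable_const a)]
      simp
    -- Both laws have mass one, so subtracting `a` from `h` keeps the difference and makes the sup
    -- bound `b - a`.
    rw [← sub_sub_sub_cancel_right _ _ a, ← hsub, ← hsub,
      multivariateGaussian_diagonal_eq_map_pi m fun i => (hv i).le,
      multivariateGaussian_diagonal_eq_map_pi m fun i => (hw i).le,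
      integral_map_equiv, integral_map_equiv]
    have key := abs_integral_pi_gaussianReal_sub_le (fun i => m i) (fun i => (v i).toNNReal)
      (fun i => (w i).toNNReal) (fun i => (Real.toNNReal_pos.2 (hv i)).ne')
      (fun i => Real.toNNReal_le_toNNReal (hvw i))
      (h := fun x => h (MeasurableEquiv.toLp 2 (Fin n → ℝ) x) - a)
      ((hm.comp (MeasurableEquiv.measurable _)).sub_const a) (c := b - a) (fun x => by
        rw [abs_of_nonneg (sub_nonneg.2 (ha _))]
        exact sub_le_sub_right (hb _) a)
    simpa only [Real.coe_toNNReal _ (hv _).le, Real.coe_toNNReal _ (hw _).le] using key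

/-- Scaled sums of independent normal vectors with diagonal covariance matrices. -/
lemma map_smul_sum_eq_multivariateGaussian {Ω ι : Type*} [MeasurableSpace Ω] [Fintype ι]
    {P : Measure Ω} [IsProbabilityMeasure P] {X : ι → Ω → EuclideanSpace ℝ (Fin n)}
    {m : ι → EuclideanSpace ℝ (Fin n)} {v : ι → Fin n → ℝ} (hv : ∀ s i, 0 ≤ v s i)
    (hX : ∀ s, HasLaw (X s) (multivariateGaussian (m s) (Matrix.diagonal (v s))) P)
    (hind : iIndepFun X P) (r : ℝ) :
    P.map (fun ω => r • ∑ s, X s ω) =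
      multivariateGaussian (r • ∑ s, m s) (Matrix.diagonal fun i => r ^ 2 * ∑ s, v s i) := by
  have hXm : ∀ s, AEMeasurable (X s) P := fun s => (hX s).aemeasurable
  have hSm : AEMeasurable (∑ s, X s) P := Finset.aemeasurable_sum _ fun s _ => hXm s
  have hmap : P.map (fun ω => r • ∑ s, X s ω) = (P.map (∑ s, X s)).map (fun x => r • x) := by
    rw [AEMeasurable.map_map_of_aemeasurable (by fun_prop) hSm]
    congr 1
    funext ω
    simp
  have : IsProbabilityMeasure (P.map (fun ω => r • ∑ s, X s ω)) := by
    rw [hmap]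
    have := Measure.isProbabilityMeasure_map hSm
    exact Measure.isProbabilityMeasure_map (by fun_prop)
  apply Measure.ext_of_charFun (E := EuclideanSpace ℝ (Fin n))
  ext t
  rw [hmap, charFun_map_smul, hind.charFun_map_sum_eq_prod hXm, Finset.prod_apply,
    charFun_multivariateGaussian_diagonal _ fun i =>
      mul_nonneg (sq_nonneg r) (Finset.sum_nonneg fun s _ => hv s i)]
  simp_rw [(hX _).map_eq, charFun_multivariateGaussian_diagonal _ (hv _)]
  rw [← Complex.exp_sum, Finset.sum_comm]
  congr 1
  refine Finset.sum_congr rfl fun i _ => ?_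
  simp only [PiLp.smul_apply, smul_eq_mul, WithLp.ofLp_sum, Finset.sum_apply]
  push_cast
  rw [Finset.mul_sum, Finset.mul_sum, Finset.mul_sum, Finset.sum_mul, Finset.sum_mul,
    Finset.sum_div, ← Finset.sum_sub_distrib]
  refine Finset.sum_congr rfl fun s _ => ?_
  ring

lemma infoSet_eq_univ {K : ℕ} {μ₀ : EuclideanSpace ℝ (Fin n)} {v : Fin n → ℝ}
    {Ω : Type*} [MeasurableSpace Ω] {P : Measure Ω} {W ε : Fin K → Ω → EuclideanSpace ℝ (Fin n)}
    (hv : ∀ i, 0 < v i)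
    (hW : ∀ k, HasLaw (W k) (multivariateGaussian μ₀ (Matrix.diagonal v)) P) (k : Fin K) :
    infoSet P W ε k = Set.univ := by
  unfold infoSet
  rw [(hW k).map_eq, support_multivariateGaussian_diagonal μ₀ hv, Set.union_univ]

end Gaussian

/-! ### Laws of the protected and the aggregated information -/

section Laws

variable {K n : ℕ} {μ₀ : EuclideanSpace ℝ (Fin n)} {v w : Fin n → ℝ}
  {Ω : Type*} [MeasurableSpace Ω] {P : Measure Ω} [IsProbabilityMeasure P]
  {W ε : Fin K → Ω → EuclideanSpace ℝ (Fin n)}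

lemma map_protectedInfo (hv : ∀ i, 0 ≤ v i) (hw : ∀ i, 0 ≤ w i)
    (hW : ∀ k, HasLaw (W k) (multivariateGaussian μ₀ (Matrix.diagonal v)) P)
    (hε : ∀ k, HasLaw (ε k) (multivariateGaussian 0 (Matrix.diagonal w)) P)
    (hindep : iIndepFun (Sum.elim W ε) P) (k : Fin K) :
    P.map (protectedInfo W ε k) =
      multivariateGaussian μ₀ (Matrix.diagonal fun i => v i + w i) := by
  -- The pair `W k`, `ε k` is a subfamily indexed by `Bool`, hence independent; the scaled sum lemma
  -- applies with factor `1`.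
  have hinj : Function.Injective
      (fun b : Bool => if b then (Sum.inl k : Fin K ⊕ Fin K) else Sum.inr k) := by
    intro a b
    cases a <;> cases b <;> simp
  have h := map_smul_sum_eq_multivariateGaussian
    (X := fun b : Bool => Sum.elim W ε (if b then (Sum.inl k : Fin K ⊕ Fin K) else Sum.inr k))
    (m := fun b : Bool => if b then μ₀ else 0) (v := fun b : Bool => if b then v else w)
    (by intro b i; cases b <;> simp [hv, hw])
    (by intro b; cases b <;> simp [hW, hε]) (hindep.precomp hinj) 1
  rw [show protectedInfo W ε k = fun ω => W k ω + ε k ω from rfl]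
  simpa using h

lemma map_aggregate (hK : 0 < K) (hv : ∀ i, 0 ≤ v i)
    (hW : ∀ k, HasLaw (W k) (multivariateGaussian μ₀ (Matrix.diagonal v)) P)
    (hindep : iIndepFun W P) :
    P.map (aggregate W) = multivariateGaussian μ₀ (Matrix.diagonal fun i => v i / K) := by
  have hK' : (K : ℝ) ≠ 0 := by positivity
  have h := map_smul_sum_eq_multivariateGaussian (fun _ => hv) hW hindep (1 / (K : ℝ))
  unfold aggregate
  rw [h]
  congr 2
  · simp only [Finset.sum_const, Finset.card_univ, Fintype.card_fin, ← Nat.cast_smul_eq_nsmul ℝ,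
      smul_smul]
    rw [one_div, inv_mul_cancel₀ hK', one_smul]
  · funext i
    simp only [Finset.sum_const, Finset.card_univ, Fintype.card_fin, nsmul_eq_mul]
    field_simp

lemma map_aggregate_protectedInfo (hK : 0 < K) (hv : ∀ i, 0 ≤ v i) (hw : ∀ i, 0 ≤ w i)
    (hW : ∀ k, HasLaw (W k) (multivariateGaussian μ₀ (Matrix.diagonal v)) P)
    (hε : ∀ k, HasLaw (ε k) (multivariateGaussian 0 (Matrix.diagonal w)) P)
    (hindep : iIndepFun (Sum.elim W ε) P) :
    P.map (aggregate (protectedInfo W ε)) =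
      multivariateGaussian μ₀ (Matrix.diagonal fun i => (v i + w i) / K) := by
  have hK' : (K : ℝ) ≠ 0 := by positivity
  have h := map_smul_sum_eq_multivariateGaussian (X := Sum.elim W ε)
    (m := Sum.elim (fun _ => μ₀) fun _ => 0) (v := Sum.elim (fun _ => v) fun _ => w)
    (by rintro (k | k) i <;> simp [hv, hw])
    (by rintro (k | k) <;> simp [hW, hε]) hindep (1 / (K : ℝ))
  -- The protected average is one scaled sum of all `2K` independent vectors.
  have he : aggregate (protectedInfo W ε) =
      fun ω => (1 / (K : ℝ)) • ∑ s, Sum.elim W ε s ω := by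
    funext ω
    simp only [aggregate, protectedInfo, Fintype.sum_sum_type, Sum.elim_inl, Sum.elim_inr,
      Finset.sum_add_distrib]
  rw [he, h]
  simp only [Fintype.sum_sum_type, Sum.elim_inl, Sum.elim_inr, Finset.sum_const, Finset.card_univ,
    Fintype.card_fin, nsmul_eq_mul]
  congr 2
  · rw [smul_zero, add_zero, ← Nat.cast_smul_eq_nsmul ℝ, smul_smul, one_div,
      inv_mul_cancel₀ hK', one_smul]
  · funext i
    field_simp

end Laws

/-! ### Stability of the privacy leakage -/

/-- A finite bound forces both numbers to be positive: `0 / 0 = 0` and `a / 0 = ∞` have logarithms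
of infinite absolute value. -/
lemma exp_bounds_of_abs_log_le {a b ξ : ℝ}
    (h : (ENNReal.log (ENNReal.ofReal a / ENNReal.ofReal b)).abs ≤ ENNReal.ofReal ξ)
    (hξ : 0 ≤ ξ) : 0 < b ∧ Real.exp (-ξ) * b ≤ a ∧ a ≤ Real.exp ξ * b := by
  have hb : 0 < b := by
    by_contra hb
    rw [ENNReal.ofReal_of_nonpos (not_lt.1 hb)] at h
    rcases eq_or_ne (ENNReal.ofReal a) 0 with ha | ha
    · simp [ha] at h
    · simp [ENNReal.div_zero ha] at h
  have ha : 0 < a := by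
    by_contra ha
    simp [ENNReal.ofReal_of_nonpos (not_lt.1 ha)] at h
  rw [← ENNReal.ofReal_div_of_pos hb, ENNReal.log_ofReal_of_pos (div_pos ha hb), EReal.abs_def,
    ENNReal.ofReal_le_ofReal_iff hξ, abs_le, Real.le_log_iff_exp_le (div_pos ha hb),
    Real.log_le_iff_le_exp (div_pos ha hb), le_div_iff₀ hb, div_le_iff₀ hb] at h
  exact ⟨hb, h⟩

lemma integrable_of_isProbDensity {X : Type*} [MeasurableSpace X] {μ : Measure X} {p : X → ℝ}
    (hp : IsProbDensity μ p) : Integrable p μ := by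
  refine ⟨hp.measurable.aestronglyMeasurable, ?_⟩
  rw [hasFiniteIntegral_iff_ofReal (ae_of_all _ hp.nonneg), hp.lintegral_eq_one]
  exact ENNReal.one_lt_top

lemma integral_of_isProbDensity {X : Type*} [MeasurableSpace X] {μ : Measure X} {p : X → ℝ}
    (hp : IsProbDensity μ p) : ∫ x, p x ∂μ = 1 := by
  rw [integral_eq_lintegral_of_nonneg_ae (ae_of_all _ hp.nonneg)
    hp.measurable.aestronglyMeasurable, hp.lintegral_eq_one, ENNReal.toReal_one]

section Privacy

variable {X E : Type*} [MeasurableSpace X] [MeasurableSpace E] {μ : Measure X} {f : X → ℝ}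
  {g : X → E → ℝ} {ξ : ℝ}

lemma measurable_belief (hgm : Measurable (Function.uncurry g)) (ν : Measure E) [SFinite ν] :
    Measurable (belief g ν) :=
  (StronglyMeasurable.integral_prod_right hgm.stronglyMeasurable).measurable

lemma belief_mem_Icc (hgm : Measurable (Function.uncurry g)) (ν : Measure E)
    [IsProbabilityMeasure ν] {d : X} {a b : ℝ} (h : ∀ w, a ≤ g d w ∧ g d w ≤ b) :
    a ≤ belief g ν d ∧ belief g ν d ≤ b := by
  have hi : Integrable (g d) ν :=
    Integrable.of_bound (hgm.of_uncurry_left).aestronglyMeasurable (max |a| |b|)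
      (ae_of_all _ fun w => abs_le_max_abs_abs (h w).1 (h w).2)
  unfold belief
  constructor
  · simpa using integral_mono (integrable_const a) hi fun w => (h w).1
  · simpa using integral_mono hi (integrable_const b) fun w => (h w).2

/-- Stability of the privacy leakage when the law of the model information is perturbed by at
most `T` in total variation. -/
lemma sqrt_jsDens_belief_le (hξ : 0 ≤ ξ) (hf : IsProbDensity μ f)
    (hgm : Measurable (Function.uncurry g))
    (hfg : ∀ d w, 0 < f d ∧ Real.exp (-ξ) * f d ≤ g d w ∧ g d w ≤ Real.exp ξ * f d)
    (ν₁ ν₂ : Measure E) [IsProbabilityMeasure ν₁] [IsProbabilityMeasure ν₂] {T : ℝ} (hT : 0 ≤ T)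
    (hν : ∀ (h : E → ℝ) (a b : ℝ), Measurable h → (∀ x, a ≤ h x) → (∀ x, h x ≤ b) →
      |∫ x, h x ∂ν₁ - ∫ x, h x ∂ν₂| ≤ (b - a) * T) :
    Real.sqrt (jsDens μ (belief g ν₁) f) ≤
      Real.sqrt (jsDens μ (belief g ν₂) f) + (Real.exp (2 * ξ) - 1) / 2 * T := by
  have hE : Nonempty E := nonempty_of_isProbabilityMeasure ν₁
  have hf0 : ∀ d, 0 < f d := fun d => (hfg d hE.some).1
  have hfi := integrable_of_isProbDensity hf
  have hb : ∀ (ν : Measure E) [IsProbabilityMeasure ν] (d : X),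
      Real.exp (-ξ) * f d ≤ belief g ν d ∧ belief g ν d ≤ Real.exp ξ * f d :=
    fun ν _ d => belief_mem_Icc hgm ν fun w => (hfg d w).2
  have hb0 : ∀ (ν : Measure E) [IsProbabilityMeasure ν] (d : X), 0 < belief g ν d :=
    fun ν _ d => (mul_pos (Real.exp_pos _) (hf0 d)).trans_le (hb ν d).1
  have hbi : ∀ (ν : Measure E) [IsProbabilityMeasure ν], Integrable (belief g ν) μ := by
    intro ν _
    refine (hfi.const_mul (Real.exp ξ)).mono' (measurable_belief hgm ν).aestronglyMeasurable
      (ae_of_all _ fun d => ?_)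
    rw [Real.norm_of_nonneg (hb0 ν d).le]
    exact (hb ν d).2
  -- For fixed `d`, the function `g d` ranges in an interval of length `(exp ξ - exp (-ξ)) * f d`,
  -- so this times `T` bounds the gap between the beliefs.
  have hjs := jsDens_le_of_abs_sub_le (b := (Real.exp ξ - Real.exp (-ξ)) * T) (Real.exp_pos (-ξ))
    hf0 hfi (integral_of_isProbDensity hf) (measurable_belief hgm ν₁) (measurable_belief hgm ν₂)
    (hbi ν₁) (hbi ν₂) (fun d => (hb ν₁ d).1) (fun d => (hb ν₂ d).1) fun d => by
      refine (hν (g d) _ _ (hgm.of_uncurry_left) (fun w => (hfg d w).2.1)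
        fun w => (hfg d w).2.2).trans (le_of_eq ?_)
      ring
  have htri := sqrt_jsDens_triangle (measurable_belief hgm ν₁) (measurable_belief hgm ν₂)
    hf.measurable (hb0 ν₁) (hb0 ν₂) hf0 (hbi ν₁) (hbi ν₂) hfi
  have hC : 0 ≤ (Real.exp (2 * ξ) - 1) / 2 * T := by
    have : 1 ≤ Real.exp (2 * ξ) := Real.one_le_exp (by positivity)
    exact mul_nonneg (by linarith) hT
  have hsq : Real.sqrt (jsDens μ (belief g ν₁) (belief g ν₂)) ≤
      (Real.exp (2 * ξ) - 1) / 2 * T := by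
    refine Real.sqrt_le_iff.2 ⟨hC, hjs.trans ?_⟩
    have h1 : 1 ≤ Real.exp ξ := Real.one_le_exp hξ
    have h2 : Real.exp (2 * ξ) = Real.exp ξ ^ 2 := by rw [← Real.exp_nat_mul]; norm_num
    rw [h2, Real.exp_neg]
    -- The bound is `exp (-ξ) * (C₃ * T)²`; the factor `exp (-ξ) ≤ 1` is then dropped.
    have h3 : ((Real.exp ξ - (Real.exp ξ)⁻¹) * T) ^ 2 / (4 * (Real.exp ξ)⁻¹) =
        (Real.exp ξ)⁻¹ * ((Real.exp ξ ^ 2 - 1) / 2 * T) ^ 2 := by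
      field_simp
      ring
    rw [h3]
    exact mul_le_of_le_one_left (sq_nonneg _) (inv_le_one_of_one_le₀ h1)
  linarith

end Privacy

/-! ### Stability of the expected utility -/

lemma datasetUtility_mem_Icc {E Z : Type*} {U : E → Z → ℝ} {C : ℝ}
    (h : ∀ w z, 0 ≤ U w z ∧ U w z ≤ C) (w : E) (D : Dataset Z) :
    0 ≤ datasetUtility U w D ∧ datasetUtility U w D ≤ C := by
  unfold datasetUtility
  refine ⟨mul_nonneg (by positivity) (Finset.sum_nonneg fun j _ => (h w _).1), ?_⟩
  rw [one_div, inv_mul_le_iff₀ (by positivity)]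
  refine (Finset.sum_le_card_nsmul _ _ C fun j _ => (h w _).2).trans (le_of_eq ?_)
  simp

section Utility

variable {E Z : Type*} [MeasurableSpace E] [MeasurableSpace Z] {U : E → Z → ℝ}

/-- Lets functions of a random data set be checked separately for each size. -/
lemma measurable_of_sigma {ι Y : Type*} {β : ι → Type*} [∀ i, MeasurableSpace (β i)]
    [MeasurableSpace Y] {F : (Σ i, β i) → Y} (h : ∀ i, Measurable fun b : β i => F ⟨i, b⟩) :
    Measurable F :=
  fun _ hs => MeasurableSpace.measurableSet_iInf.2 fun i => h i hs

lemma measurable_integral_datasetUtility (hU : Measurable (Function.uncurry U)) (ν : Measure E)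
    [SFinite ν] : Measurable fun D : Dataset Z => ∫ w, datasetUtility U w D ∂ν := by
  refine measurable_of_sigma fun m => ?_
  have h : Measurable (Function.uncurry fun (b : Fin (m + 1) → Z) (w : E) =>
      datasetUtility U w ⟨m, b⟩) := by
    have hs : Measurable fun q : (Fin (m + 1) → Z) × E => ∑ j, U q.2 (q.1 j) :=
      Finset.measurable_sum _ fun j _ =>
        hU.comp (measurable_snd.prodMk ((measurable_pi_apply j).comp measurable_fst))
    exact hs.const_mul (1 / ((m + 1 : ℕ) : ℝ))
  exact (StronglyMeasurable.integral_prod_right h.stronglyMeasurable).measurable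

lemma expectedUtility_sub_le {C T : ℝ} (hUm : Measurable (Function.uncurry U))
    (hU : ∀ w z, 0 ≤ U w z ∧ U w z ≤ C)
    (Q : Measure (Dataset Z)) [IsProbabilityMeasure Q]
    (ν₁ ν₂ : Measure E) [IsProbabilityMeasure ν₁] [IsProbabilityMeasure ν₂]
    (hν : ∀ (h : E → ℝ) (a b : ℝ), Measurable h → (∀ x, a ≤ h x) → (∀ x, h x ≤ b) →
      |∫ x, h x ∂ν₁ - ∫ x, h x ∂ν₂| ≤ (b - a) * T) :
    expectedUtility U Q ν₁ - expectedUtility U Q ν₂ ≤ C * T := by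
  have hm : ∀ D : Dataset Z, Measurable fun w => datasetUtility U w D := by
    intro D
    unfold datasetUtility
    exact Measurable.const_mul (Finset.measurable_sum _ fun j _ => hUm.of_uncurry_right) _
  have hi : ∀ (ν : Measure E) [IsProbabilityMeasure ν],
      Integrable (fun D : Dataset Z => ∫ w, datasetUtility U w D ∂ν) Q := by
    intro ν _
    refine Integrable.of_bound (measurable_integral_datasetUtility hUm ν).aestronglyMeasurable C
      (ae_of_all _ fun D => ?_)
    have := norm_integral_le_of_norm_le_const (μ := ν) (C := C)
      (f := fun w => datasetUtility U w D) (ae_of_all _ fun w => by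
        rw [Real.norm_of_nonneg (datasetUtility_mem_Icc hU w D).1]
        exact (datasetUtility_mem_Icc hU w D).2)
    simpa using this
  unfold expectedUtility
  rw [← integral_sub (hi ν₁) (hi ν₂)]
  have := integral_mono ((hi ν₁).sub (hi ν₂)) (integrable_const (C * T)) fun D => by
    have := hν (fun w => datasetUtility U w D) 0 C (hm D)
      (fun w => (datasetUtility_mem_Icc hU w D).1) fun w => (datasetUtility_mem_Icc hU w D).2
    rw [sub_zero] at this
    exact (le_abs_self _).trans this
  simpa using this

end Utility

end FedTradeoff

/-! ### The two trade-off bounds -/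

theorem theorem2
    {K n : ℕ} (hK : 0 < K)
    -- Gaussian model information, Gaussian noise, all independent
    (μ₀ : EuclideanSpace ℝ (Fin n)) (σ : Fin n → ℝ) (hσ : ∀ i, 0 < σ i)
    (σε : ℝ) (hσε : 0 ≤ σε)
    {Ω : Type*} [MeasurableSpace Ω] (P : Measure Ω) [IsProbabilityMeasure P]
    (W ε : Fin K → Ω → EuclideanSpace ℝ (Fin n))
    (hW : ∀ k, HasLaw (W k)
      (multivariateGaussian μ₀ (Matrix.diagonal fun i => σ i ^ 2)) P)
    (hε : ∀ k, HasLaw (ε k)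
      (multivariateGaussian 0 (Matrix.diagonal fun _ => σε ^ 2)) P)
    (hindep : iIndepFun (Sum.elim W ε) P)
    -- private data `D_k`: prior density `f k`, conditional density `g k d w` of `d` given `w`
    {𝒟 : Fin K → Type*} [∀ k, MeasurableSpace (𝒟 k)]
    (μ : ∀ k, Measure (𝒟 k)) [∀ k, SigmaFinite (μ k)]
    (f : ∀ k, 𝒟 k → ℝ) (hf : ∀ k, FedTradeoff.IsProbDensity (μ k) (f k))
    (g : ∀ k, 𝒟 k → EuclideanSpace ℝ (Fin n) → ℝ)
    (hg_meas : ∀ k, Measurable (Function.uncurry (g k)))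
    (hg : ∀ k w, FedTradeoff.IsProbDensity (μ k) (fun d => g k d w))
    -- `ξ` is the maximum over the clients of the maximum privacy leakage
    (ξ : ℝ)
    (hξ : ENNReal.ofReal ξ =
      ⨆ k, FedTradeoff.maxLeakage (f k) (g k) (FedTradeoff.infoSet P W ε k))
    (hξ_nonneg : 0 ≤ ξ)
    -- random data sets of records, and the utility of a model on a record
    {𝒵 : Fin K → Type*} [∀ k, MeasurableSpace (𝒵 k)]
    (Q : ∀ k, Measure (FedTradeoff.Dataset (𝒵 k))) [∀ k, IsProbabilityMeasure (Q k)]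
    (U : ∀ k, EuclideanSpace ℝ (Fin n) → 𝒵 k → ℝ)
    (hU_meas : ∀ k, Measurable (Function.uncurry (U k)))
    (C₄ : ℝ)
    (hU : ∀ k, ∀ w ∈ FedTradeoff.infoSet P W ε k, ∀ z, 0 ≤ U k w z ∧ U k w z ≤ C₄) :
    -- `C₁ ≤ ε_p + C₃ min {1, σ_ε² √(∑ 1/σ_i⁴)}` with `C₃ = (e^{2ξ} - 1) / 2`
    FedTradeoff.averageSqrtJS μ (fun k => FedTradeoff.belief (g k) (P.map (W k))) f
        ≤ FedTradeoff.averageSqrtJS μ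
            (fun k => FedTradeoff.belief (g k) (P.map (FedTradeoff.protectedInfo W ε k))) f
          + (Real.exp (2 * ξ) - 1) / 2 * min 1 (σε ^ 2 * Real.sqrt (∑ i, 1 / σ i ^ 4))
    ∧
    -- `ε_u ≤ C₄ min {1, σ_ε² √(∑ 1/σ_i⁴)}`
    FedTradeoff.utilityLoss U Q
        (P.map (FedTradeoff.aggregate W))
        (P.map (FedTradeoff.aggregate (FedTradeoff.protectedInfo W ε)))
      ≤ C₄ * min 1 (σε ^ 2 * Real.sqrt (∑ i, 1 / σ i ^ 4)) := by
  have hv : ∀ i, 0 < σ i ^ 2 := fun i => pow_pos (hσ i) 2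
  have hw : ∀ _ : Fin n, 0 ≤ σε ^ 2 := fun _ => sq_nonneg σε
  have hK' : (K : ℝ) ≠ 0 := by positivity
  have huniv : ∀ k, FedTradeoff.infoSet P W ε k = Set.univ := fun k =>
    FedTradeoff.infoSet_eq_univ hv hW k
  set T : ℝ := min 1 (σε ^ 2 * Real.sqrt (∑ i, 1 / σ i ^ 4)) with hT
  have hT0 : 0 ≤ T := le_min zero_le_one (by positivity)
  -- The scale `c` cancels in the relative variances; `c = 1` serves a single client and `c = K` the
  -- average.
  have hTeq : ∀ c : ℝ, 0 < c →
      min 1 (Real.sqrt (∑ i, (((σ i ^ 2 + σε ^ 2) / c - σ i ^ 2 / c) / (σ i ^ 2 / c)) ^ 2)) =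
        T := by
    intro c hc
    rw [hT]
    congr 1
    have h1 : ∀ i, (((σ i ^ 2 + σε ^ 2) / c - σ i ^ 2 / c) / (σ i ^ 2 / c)) ^ 2 =
        (σε ^ 2) ^ 2 * (1 / σ i ^ 4) := by
      intro i
      have := (hσ i).ne'
      field_simp
      ring
    simp_rw [h1]
    rw [← Finset.mul_sum, Real.sqrt_mul (sq_nonneg _), Real.sqrt_sq (sq_nonneg _)]
  have hTV : ∀ c : ℝ, 0 < c → ∀ (h : EuclideanSpace ℝ (Fin n) → ℝ) (a b : ℝ), Measurable h →
      (∀ x, a ≤ h x) → (∀ x, h x ≤ b) →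
      |∫ x, h x ∂multivariateGaussian μ₀ (Matrix.diagonal fun i => σ i ^ 2 / c) -
        ∫ x, h x ∂multivariateGaussian μ₀ (Matrix.diagonal fun i => (σ i ^ 2 + σε ^ 2) / c)| ≤
        (b - a) * T := by
    intro c hc h a b hm ha hb
    rw [← hTeq c hc]
    refine FedTradeoff.abs_integral_multivariateGaussian_sub_le μ₀ (fun i => div_pos (hv i) hc)
      (fun i => ?_) hm ha hb
    gcongr
    linarith [hw i]
  constructor
  · have hclient : ∀ k, Real.sqrt (FedTradeoff.jsDens (μ k)
        (FedTradeoff.belief (g k) (P.map (W k))) (f k)) ≤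
        Real.sqrt (FedTradeoff.jsDens (μ k)
          (FedTradeoff.belief (g k) (P.map (FedTradeoff.protectedInfo W ε k))) (f k)) +
        (Real.exp (2 * ξ) - 1) / 2 * T := by
      intro k
      rw [(hW k).map_eq,
        FedTradeoff.map_protectedInfo (fun i => (hv i).le) hw hW hε hindep k]
      refine FedTradeoff.sqrt_jsDens_belief_le hξ_nonneg (hf k) (hg_meas k) (fun d w => ?_) _ _ hT0
        (by simpa only [div_one] using hTV 1 one_pos)
      refine FedTradeoff.exp_bounds_of_abs_log_le ?_ hξ_nonneg
      have hmem : w ∈ FedTradeoff.infoSet P W ε k := by rw [huniv k]; trivial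
      rw [hξ]
      refine le_iSup_of_le k (le_iSup₂_of_le w hmem (le_iSup_of_le d le_rfl))
    unfold FedTradeoff.averageSqrtJS
    calc _ ≤ 1 / (K : ℝ) * ∑ k, (Real.sqrt (FedTradeoff.jsDens (μ k)
          (FedTradeoff.belief (g k) (P.map (FedTradeoff.protectedInfo W ε k))) (f k)) +
          (Real.exp (2 * ξ) - 1) / 2 * T) := by
            gcongr with k
            exact hclient k
      _ = _ := by
        rw [Finset.sum_add_distrib, mul_add, Finset.sum_const, Finset.card_univ, Fintype.card_fin,
          nsmul_eq_mul, ← mul_assoc, one_div, inv_mul_cancel₀ hK', one_mul]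
  · have hindW : iIndepFun W P := by
      simpa only [Sum.elim_inl] using hindep.precomp (g := Sum.inl) Sum.inl_injective
    rw [FedTradeoff.map_aggregate hK (fun i => (hv i).le) hW hindW,
      FedTradeoff.map_aggregate_protectedInfo hK (fun i => (hv i).le) hw hW hε hindep]
    have hclient := fun k => FedTradeoff.expectedUtility_sub_le (hU_meas k)
      (fun w z => hU k w (by rw [huniv k]; trivial) z) (Q k) _ _
      (hTV K (by positivity))
    unfold FedTradeoff.utilityLoss
    calc _ ≤ 1 / (K : ℝ) * ∑ _k : Fin K, C₄ * T := by
            gcongr with k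
            exact hclient k
      _ = _ := by
        rw [Finset.sum_const, Finset.card_univ, Fintype.card_fin,
          nsmul_eq_mul, ← mul_assoc, one_div, inv_mul_cancel₀ hK', one_mul]
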